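/- Call a group $G$ an \emph{integral} of a group $A$ if the derived subgroup $G'$ is isomorphic to $A$, and write $C_n$ for the cyclic group of order $n$. (a) There is a function $\varepsilon\colon\mathbb N\to\mathbb R$ with $\varepsilon(n)\to 0$ as $n\to\infty$ such that every finite abelian group $A$ has an integral of order at most $|A|^{1+\varepsilon(|A|)}$. Moreover, this integral can be chosen as a semidirect product $B\rtimes Q$, where $B$ is a finite abelian group and $Q$ is a subgroup of $C_2\times C_3\times C_7$. (b) There is no constant $c$ such that every finite abelian group $A$ has a finite integral of order at most $c|A|$. Moreover, for every $N\in\mathbb N$ there is $m_0$ such that, for all $m\ge m_0$ and all pairwise distinct non-negative integers $a_1,\dots,a_m$, every group $G$ with $G'\cong C_{2^{a_1}}\times\cdots\times C_{2^{a_m}}$ satisfies $|G:G'|\ge N$ (where the index may be infinite). -/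

import Mathlib

open Filter Topology

universe u

/-- `G` is an integral of the group `A`: the derived subgroup of `G` is (isomorphic to) `A`. -/
def IsGroupIntegral (G : Type*) [Group G] (A : Type*) [Group A] : Prop :=
  Nonempty (commutator G ≃* A)

/-- The cyclic group of order `n` (for `n ≠ 0`), written multiplicatively. -/
abbrev Cyc (n : ℕ) : Type := Multiplicative (ZMod n)

/-! Upper bound. Inverting an abelian group `D` gives a semidirect product with derived subgroup `D
^ 2`. An automorphism `g` of `E × E` with `g² + g + 1 = 0` gives all of `E × E` when 3 does not
divide `|E|`, because `g - 1` is then invertible. Odd-order factors consist of squares, and equal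
cyclic 2-factors are paired off into `E × E`. The `k` leftover 2-factors have distinct orders `2 ^
s`; each is the square of `C_{2 ^ (s + 1)}` and costs a factor 2. Distinct positive exponents sum to
at least `k² / 2`, so the cost `2 ^ k` is `|A| ^ o(1)`.

Lower bound. Let `A = G'` be a product of cyclic 2-groups of distinct orders and `n = |G : A|`
finite. The filtration `A[2 ^ j] A²` has steps of index at most 2, on which `G` can only act
trivially. Descending it shows that `A` is normally generated by squares and by commutators of coset
representatives (`commutator_le_normalClosure_of_layers`). As `A` is abelian, each of these `n²`
commutators has at most `n` conjugates, so `A / A²` has dimension at most `n³`, while it has rank at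
least `m - 1`. -/

open scoped commutatorElement

/-! ### Torsion layers and normal generation of the derived subgroup -/

/-- `z` is the product of an element of order dividing `2 ^ j` and a square. -/
def IsTorsionMulSquare {C : Type*} [Group C] (j : ℕ) (z : C) : Prop :=
  ∃ u v : C, u ^ 2 ^ j = 1 ∧ z = u * v ^ 2

/-- The subgroups `C[2 ^ j] * C ^ 2` of `C` have successive indices at most two. -/
def HasSmallTorsionLayers (C : Type*) [Group C] : Prop :=
  ∀ (j : ℕ) (x y : C), x ^ 2 ^ (j + 1) = 1 → y ^ 2 ^ (j + 1) = 1 →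
    IsTorsionMulSquare j x ∨ IsTorsionMulSquare j y ∨ IsTorsionMulSquare j (x * y⁻¹)

theorem IsTorsionMulSquare.map {C D : Type*} [Group C] [Group D] (f : C →* D) {j : ℕ} {z : C}
    (h : IsTorsionMulSquare j z) : IsTorsionMulSquare j (f z) := by
  obtain ⟨u, v, hu, rfl⟩ := h
  exact ⟨f u, f v, by rw [← map_pow, hu, map_one], by rw [map_mul, map_pow]⟩

theorem HasSmallTorsionLayers.of_mulEquiv {C D : Type*} [Group C] [Group D] (e : C ≃* D)
    (h : HasSmallTorsionLayers D) : HasSmallTorsionLayers C := by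
  intro j x y hx hy
  have key (z : C) (hz : IsTorsionMulSquare j (e z)) : IsTorsionMulSquare j z := by
    simpa using hz.map e.symm.toMonoidHom
  have := h j (e x) (e y) (by rw [← map_pow, hx, map_one]) (by rw [← map_pow, hy, map_one])
  rw [← map_inv, ← map_mul] at this
  exact this.imp (key _) (Or.imp (key _) (key _))

theorem commutator_le_normalClosure_of_layers {G : Type*} [Group G]
    (T : Set G) (hT : ∀ g : G, ∃ t ∈ T, g * t⁻¹ ∈ commutator G)
    (hexp : ∃ J, ∀ x ∈ commutator G, x ^ 2 ^ J = 1)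
    (hlay : HasSmallTorsionLayers (commutator G)) :
    commutator G ≤ Subgroup.normalClosure
      ({x | ∃ s ∈ T, ∃ t ∈ T, x = ⁅s, t⁆} ∪ {x | ∃ v ∈ commutator G, x = v ^ 2}) := by
  set A := commutator G with hA
  set S : Set G := {x | ∃ s ∈ T, ∃ t ∈ T, x = ⁅s, t⁆} ∪ {x | ∃ v ∈ A, x = v ^ 2} with hS
  -- `M J` contains `A` once `2 ^ J` kills `A`, and `M 0` is the target; `hstep` lowers `j` by one.
  let M (j : ℕ) : Subgroup G := Subgroup.normalClosure (S ∪ {x | x ∈ A ∧ x ^ 2 ^ j = 1})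
  have hSM (j : ℕ) {x : G} (hx : x ∈ S) : x ∈ M j := Subgroup.subset_normalClosure (Or.inl hx)
  have hWM (j : ℕ) (z : A) (hz : IsTorsionMulSquare j z) : (z : G) ∈ M j := by
    obtain ⟨u, v, hu, rfl⟩ := hz
    refine mul_mem (Subgroup.subset_normalClosure (Or.inr ⟨u.2, ?_⟩))
      (hSM j (Or.inr ⟨v, v.2, rfl⟩))
    simpa using congrArg Subtype.val hu
  have hstep (j : ℕ) (h : A ≤ M (j + 1)) : A ≤ M j := by
    have : (M j).Normal := Subgroup.normalClosure_normal
    let π := QuotientGroup.mk' (M j)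
    have hker (x : G) : π x = 1 ↔ x ∈ M j := QuotientGroup.eq_one_iff x
    -- Modulo `M j` the `2 ^ (j + 1)`-torsion has at most one nontrivial image. Conjugation must fix
    -- it, so the image is central.
    have hcen : A ≤ (Subgroup.center (G ⧸ M j)).comap π := by
      refine h.trans (Subgroup.normalClosure_le_normal ?_)
      rintro x (hx | ⟨hxA, hx⟩)
      · change π x ∈ Subgroup.center (G ⧸ M j)
        rw [(hker x).2 (hSM j hx)]
        exact one_mem _
      · change π x ∈ Subgroup.center (G ⧸ M j)
        rw [Subgroup.mem_center_iff]
        intro q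
        obtain ⟨g, rfl⟩ := QuotientGroup.mk'_surjective (M j) q
        have hconj : g * x * g⁻¹ ∈ A := (inferInstance : A.Normal).conj_mem x hxA g
        rcases hlay j ⟨g * x * g⁻¹, hconj⟩ ⟨x, hxA⟩
          (Subtype.ext (by simp [conj_pow, hx])) (Subtype.ext (by simpa using hx)) with h | h | h
        · have h1 := hWM j _ h
          have h2 : x ∈ M j := by
            have := this.conj_mem _ h1 g⁻¹
            simpa [mul_assoc] using this
          change π g * π x = π x * π g
          rw [(hker x).2 h2]; simp
        · change π g * π x = π x * π g
          rw [(hker x).2 (hWM j _ h)]; simp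
        · have h1 := (hker _).2 (hWM j _ h)
          change π g * π x = π x * π g
          simp only [Subgroup.coe_mul, Subgroup.coe_inv, map_mul, map_inv] at h1
          rwa [mul_inv_eq_one, mul_inv_eq_iff_eq_mul] at h1
    have hcA (a : G) (ha : a ∈ A) (q : G ⧸ M j) : π a * q = q * π a :=
      ((Subgroup.mem_center_iff.1 (hcen ha)) q).symm
    -- With `A` central modulo `M j`, a commutator depends only on the cosets of its entries, so `T`
    -- suffices.
    rw [hA, commutator_def, Subgroup.commutator_le]
    intro g _ h _
    obtain ⟨s, hs, hgs⟩ := hT g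
    obtain ⟨t, ht, hht⟩ := hT h
    have hst : π s * π t = π t * π s := by
      have := (hker _).2 (hSM j (Or.inl ⟨s, hs, t, ht, rfl⟩))
      rwa [map_commutatorElement, commutatorElement_eq_one_iff_mul_comm] at this
    rw [← hker, map_commutatorElement, commutatorElement_eq_one_iff_mul_comm]
    have e1 : π g = π (g * s⁻¹) * π s := by simp
    have e2 : π h = π (h * t⁻¹) * π t := by simp
    rw [e1, e2]
    have c1 := hcA _ hgs
    have c2 := hcA _ hht
    generalize π (g * s⁻¹) = a at c1 ⊢
    generalize π (h * t⁻¹) = b at c2 ⊢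
    calc a * π s * (b * π t) = a * (b * π s) * π t := by rw [c2 (π s)]; group
      _ = b * a * (π s * π t) := by rw [← c1 b]; group
      _ = b * (a * π t) * π s := by rw [hst]; group
      _ = b * π t * (a * π s) := by rw [c1]; group
  have hall (j : ℕ) : A ≤ M j → A ≤ M 0 := by
    induction j with
    | zero => exact id
    | succ j ih => exact fun h => ih (hstep j h)
  obtain ⟨J, hJ⟩ := hexp
  refine (hall J fun x hx => Subgroup.subset_normalClosure (Or.inr ⟨hx, hJ x hx⟩)).trans
    (Subgroup.normalClosure_le_normal ?_)
  rintro x (hx | ⟨-, hx⟩)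
  · exact Subgroup.subset_normalClosure hx
  · rw [pow_zero, pow_one] at hx
    rw [hx]
    exact one_mem _

theorem card_le_index_commutator_pow_three {G : Type*} [Group G] [Finite (G ⧸ commutator G)]
    (hcomm : ∀ x ∈ commutator G, ∀ y ∈ commutator G, x * y = y * x)
    (hexp : ∃ J, ∀ x ∈ commutator G, x ^ 2 ^ J = 1)
    (hlay : HasSmallTorsionLayers (commutator G))
    {ι : Type*} [Fintype ι] (f : commutator G →* Multiplicative (ι → ZMod 2))
    (hf : Function.Surjective f) :
    Fintype.card ι ≤ Nat.card (G ⧸ commutator G) ^ 3 := by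
  have := Fintype.ofFinite (G ⧸ commutator G)
  let r : G ⧸ commutator G → G := Quotient.out
  have hr (g : G) : g * (r g)⁻¹ ∈ commutator G := by
    have h : (r g)⁻¹ * g ∈ commutator G := QuotientGroup.eq.1 (QuotientGroup.out_eq' (g : G ⧸ _))
    simpa using (inferInstance : (commutator G).Normal).mem_comm h
  have hmem (s t g : G) : g * ⁅s, t⁆ * g⁻¹ ∈ commutator G :=
    (inferInstance : (commutator G).Normal).conj_mem _
      (Subgroup.commutator_mem_commutator (Subgroup.mem_top _) (Subgroup.mem_top _)) _
  -- One vector for each conjugating coset and each pair of representatives: `n³` in all.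
  let F : (G ⧸ commutator G) × (G ⧸ commutator G) × (G ⧸ commutator G) → ι → ZMod 2 :=
    fun q => (f ⟨r q.1 * ⁅r q.2.1, r q.2.2⁆ * (r q.1)⁻¹, hmem _ _ _⟩).toAdd
  let L : Subgroup G := ((AddSubgroup.toSubgroup
    (Submodule.span (ZMod 2) (Set.range F)).toAddSubgroup).comap f).map (commutator G).subtype
  have hL : commutator G ≤ L := by
    refine (commutator_le_normalClosure_of_layers (Set.range r)
      (fun g => ⟨_, ⟨g, rfl⟩, hr g⟩) hexp hlay).trans ?_
    rw [Subgroup.normalClosure, Subgroup.closure_le]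
    intro x hx
    rw [Group.mem_conjugatesOfSet_iff] at hx
    obtain ⟨y, hy, hyx⟩ := hx
    obtain ⟨g, rfl⟩ := isConj_iff.1 hyx
    rcases hy with ⟨_, ⟨s, rfl⟩, _, ⟨t, rfl⟩, rfl⟩ | ⟨v, hv, rfl⟩
    · have hg : g * ⁅r s, r t⁆ * g⁻¹ = r g * ⁅r s, r t⁆ * (r g)⁻¹ := by
        have h1 := hcomm _ (hr g) _ (hmem (r s) (r t) (r g))
        calc g * ⁅r s, r t⁆ * g⁻¹
            = (g * (r g)⁻¹) * (r g * ⁅r s, r t⁆ * (r g)⁻¹) * (g * (r g)⁻¹)⁻¹ := by group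
          _ = _ := by rw [h1]; group
      rw [hg]
      exact ⟨⟨_, hmem _ _ _⟩, Submodule.subset_span ⟨(g, s, t), rfl⟩, rfl⟩
    · have hv' : g * v * g⁻¹ ∈ commutator G :=
        (inferInstance : (commutator G).Normal).conj_mem v hv g
      refine ⟨⟨g * v * g⁻¹, hv'⟩ ^ 2, ?_, by simp [conj_pow]⟩
      rw [SetLike.mem_coe, Subgroup.mem_comap]
      have : f (⟨g * v * g⁻¹, hv'⟩ ^ 2) = 1 := by
        rw [map_pow]
        generalize f _ = w
        apply Multiplicative.toAdd.injective
        funext i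
        change (2 • w.toAdd) i = 0
        rw [Pi.smul_apply, two_nsmul]
        exact CharTwo.add_self_eq_zero _
      rw [this]
      exact one_mem _
  have hspan : Submodule.span (ZMod 2) (Set.range F) = ⊤ := by
    rw [eq_top_iff]
    intro w _
    obtain ⟨x, hx⟩ := hf (Multiplicative.ofAdd w)
    obtain ⟨y, hy, hyx⟩ := hL x.2
    have : y = x := Subtype.ext hyx
    subst this
    rw [SetLike.mem_coe, Subgroup.mem_comap, hx] at hy
    exact hy
  have hle := finrank_range_le_card (R := ZMod 2) F
  rw [Set.finrank, hspan, finrank_top, Module.finrank_fintype_fun_eq_card] at hle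
  refine hle.trans (le_of_eq ?_)
  rw [Fintype.card_prod, Fintype.card_prod, Nat.card_eq_fintype_card]
  ring

/-! ### Products of cyclic 2-groups of distinct orders -/

theorem ZMod.exists_two_mul_of_two_pow_mul_eq_zero {a j : ℕ} (h : j < a) (x : ZMod (2 ^ a))
    (hx : 2 ^ j * x = 0) : ∃ y, x = 2 * y := by
  obtain ⟨k, rfl⟩ := ZMod.intCast_surjective x
  have h1 : ((2 ^ j * k : ℤ) : ZMod (2 ^ a)) = 0 := by push_cast; exact hx
  rw [ZMod.intCast_zmod_eq_zero_iff_dvd] at h1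
  have h2 : (2 : ℤ) ^ (j + 1) ∣ 2 ^ j * k := by
    refine (pow_dvd_pow 2 h).trans ?_
    exact_mod_cast h1
  rw [pow_succ, mul_dvd_mul_iff_left (by positivity)] at h2
  obtain ⟨l, rfl⟩ := h2
  exact ⟨l, by push_cast; rfl⟩

theorem ZMod.two_mul_cases {n : ℕ} (x y : ZMod n) :
    (∃ z, x = 2 * z) ∨ (∃ z, y = 2 * z) ∨ ∃ z, x - y = 2 * z := by
  obtain ⟨k, rfl⟩ := ZMod.intCast_surjective x
  obtain ⟨l, rfl⟩ := ZMod.intCast_surjective y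
  rcases Int.even_or_odd' k with ⟨c, rfl | rfl⟩
  · exact Or.inl ⟨c, by push_cast; rfl⟩
  rcases Int.even_or_odd' l with ⟨d, rfl | rfl⟩
  · exact Or.inr (Or.inl ⟨d, by push_cast; rfl⟩)
  · exact Or.inr (Or.inr ⟨c - d, by push_cast; ring⟩)

/-- Coordinates with `a i ≤ j` are killed by `2 ^ j`, and for `a i > j + 1` the `2 ^ (j +
1)`-torsion consists of squares. Only `a i = j + 1` can obstruct. -/
theorem isTorsionMulSquare_pi_cyc {ι : Type*} {a : ι → ℕ} {j : ℕ} (x : ∀ i, Cyc (2 ^ a i))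
    (hx : x ^ 2 ^ (j + 1) = 1) (h : ∀ i, a i = j + 1 → ∃ z, (x i).toAdd = 2 * z) :
    IsTorsionMulSquare j x := by
  have key (i : ι) : ∃ u v : ZMod (2 ^ a i), 2 ^ j * u = 0 ∧ (x i).toAdd = u + 2 * v := by
    rcases lt_trichotomy (a i) (j + 1) with hi | hi | hi
    · refine ⟨(x i).toAdd, 0, ?_, by simp⟩
      have : ((2 ^ j : ℕ) : ZMod (2 ^ a i)) = 0 :=
        (ZMod.natCast_eq_zero_iff _ _).2 (pow_dvd_pow 2 (Nat.lt_succ_iff.1 hi))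
      push_cast at this
      rw [this, zero_mul]
    · obtain ⟨z, hz⟩ := h i hi
      exact ⟨0, z, by simp, by simp [hz]⟩
    · have h1 : 2 ^ (j + 1) * (x i).toAdd = 0 := by
        have := congrArg Multiplicative.toAdd (congrFun hx i)
        simpa [nsmul_eq_mul] using this
      obtain ⟨z, hz⟩ := ZMod.exists_two_mul_of_two_pow_mul_eq_zero hi _ h1
      exact ⟨0, z, by simp, by simp [hz]⟩
  choose u v hu hv using key
  refine ⟨fun i => Multiplicative.ofAdd (u i), fun i => Multiplicative.ofAdd (v i), ?_, ?_⟩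
  · funext i
    apply Multiplicative.toAdd.injective
    simpa [nsmul_eq_mul] using hu i
  · funext i
    apply Multiplicative.toAdd.injective
    simpa [nsmul_eq_mul] using hv i

theorem hasSmallTorsionLayers_pi_cyc {ι : Type*} {a : ι → ℕ} (ha : Function.Injective a) :
    HasSmallTorsionLayers (∀ i, Cyc (2 ^ a i)) := by
  intro j x y hx hy
  by_cases hj : ∃ i, a i = j + 1
  · obtain ⟨i, hi⟩ := hj
    have hi' (k : ι) (hk : a k = j + 1) : k = i := ha (hk.trans hi.symm)
    rcases ZMod.two_mul_cases (x i).toAdd (y i).toAdd with h | h | h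
    · exact Or.inl (isTorsionMulSquare_pi_cyc x hx fun k hk => hi' k hk ▸ h)
    · exact Or.inr (Or.inl (isTorsionMulSquare_pi_cyc y hy fun k hk => hi' k hk ▸ h))
    · refine Or.inr (Or.inr (isTorsionMulSquare_pi_cyc _ (by rw [mul_pow, inv_pow, hx, hy]; simp)
        fun k hk => hi' k hk ▸ ?_))
      simpa [sub_eq_add_neg] using h
  · push Not at hj
    exact Or.inl (isTorsionMulSquare_pi_cyc x hx fun i hi => absurd hi (hj i))

theorem exists_surjective_pi_cyc {ι : Type*} (a : ι → ℕ) :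
    ∃ f : (∀ i, Cyc (2 ^ a i)) →* Multiplicative ({i // a i ≠ 0} → ZMod 2),
      Function.Surjective f := by
  have hdvd (i : {i // a i ≠ 0}) : 2 ∣ 2 ^ a i := dvd_pow_self 2 i.2
  refine ⟨⟨⟨fun x => Multiplicative.ofAdd fun i => ZMod.castHom (hdvd i) (ZMod 2) (x i).toAdd,
    ?_⟩, ?_⟩, ?_⟩
  · apply Multiplicative.toAdd.injective
    funext i
    simp
  · intro x y
    apply Multiplicative.toAdd.injective
    funext i
    exact map_add (ZMod.castHom (hdvd i) (ZMod 2)) _ _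
  · intro w
    choose z hz using fun i => ZMod.castHom_surjective (hdvd i) (w.toAdd i)
    classical
    refine ⟨fun i => Multiplicative.ofAdd (if h : a i ≠ 0 then z ⟨i, h⟩ else 0), ?_⟩
    apply Multiplicative.toAdd.injective
    funext i
    change ZMod.castHom (hdvd i) (ZMod 2) (if h : a i ≠ 0 then z ⟨i, h⟩ else 0) = w.toAdd i
    rw [dif_pos i.2]
    exact hz i

/-! ### The index of the derived subgroup is unbounded -/

theorem le_index_commutator_pow_three_add_one {m : ℕ} {a : Fin m → ℕ} (ha : Function.Injective a)
    {G : Type*} [Group G] [Finite (G ⧸ commutator G)]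
    (hG : IsGroupIntegral G (∀ i, Cyc (2 ^ a i))) :
    m ≤ Nat.card (G ⧸ commutator G) ^ 3 + 1 := by
  obtain ⟨e⟩ := hG
  obtain ⟨f, hf⟩ := exists_surjective_pi_cyc a
  have hcomm : ∀ x ∈ commutator G, ∀ y ∈ commutator G, x * y = y * x := by
    intro x hx y hy
    have : (⟨x, hx⟩ : commutator G) * ⟨y, hy⟩ = ⟨y, hy⟩ * ⟨x, hx⟩ :=
      e.injective (by rw [map_mul, map_mul, mul_comm])
    exact congrArg Subtype.val this
  have hexp : ∃ J, ∀ x ∈ commutator G, x ^ 2 ^ J = 1 := by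
    refine ⟨∑ i, a i, fun x hx => ?_⟩
    have : (⟨x, hx⟩ : commutator G) ^ 2 ^ (∑ i, a i) = 1 := by
      apply e.injective
      rw [map_pow, map_one]
      funext i
      apply Multiplicative.toAdd.injective
      have : ((2 ^ ∑ i, a i : ℕ) : ZMod (2 ^ a i)) = 0 :=
        (ZMod.natCast_eq_zero_iff _ _).2
          (pow_dvd_pow 2 (Finset.single_le_sum (fun _ _ => Nat.zero_le _) (Finset.mem_univ i)))
      change (2 ^ ∑ i, a i : ℕ) • (e ⟨x, hx⟩ i).toAdd = 0
      rw [nsmul_eq_mul, this, zero_mul]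
    exact congrArg Subtype.val this
  have hcard := card_le_index_commutator_pow_three hcomm hexp
    ((hasSmallTorsionLayers_pi_cyc ha).of_mulEquiv e) (f.comp e.toMonoidHom)
    (hf.comp e.surjective)
  -- At most one factor is trivial, which accounts for the `+ 1`.
  have hsub : Fintype.card {i // a i = 0} ≤ 1 :=
    Fintype.card_le_one_iff_subsingleton.2 ⟨fun x y => Subtype.ext (ha (x.2.trans y.2.symm))⟩
  have := Fintype.card_subtype_compl (fun i => a i = 0)
  simp only [Fintype.card_fin] at this
  have h' : Fintype.card {i // ¬ a i = 0} = Fintype.card {i // a i ≠ 0} := rfl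
  omega

theorem exists_forall_le_index_commutator (N : ℕ) :
    ∃ m₀ : ℕ, ∀ m ≥ m₀, ∀ a : Fin m → ℕ, Function.Injective a → ∀ (G : Type u) [Group G],
      IsGroupIntegral G (∀ i, Cyc (2 ^ a i)) → (N : ℕ∞) ≤ ENat.card (G ⧸ commutator G) := by
  refine ⟨N ^ 3 + 2, fun m hm a ha G _ hG => ?_⟩
  by_contra! hlt
  have hfin : Finite (G ⧸ commutator G) :=
    ENat.card_lt_top.1 (hlt.trans (ENat.natCast_lt_top N))
  have hle := le_index_commutator_pow_three_add_one ha hG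
  rw [ENat.card_eq_coe_natCard, Nat.cast_lt] at hlt
  have := Nat.pow_le_pow_left hlt.le 3
  omega

theorem not_exists_linear_bound :
    ¬ ∃ c : ℝ, ∀ (A : Type u) [CommGroup A] [Finite A],
        ∃ (G : Type u) (_ : Group G) (_ : Finite G),
          IsGroupIntegral G A ∧ (Nat.card G : ℝ) ≤ c * (Nat.card A : ℝ) := by
  rintro ⟨c, hc⟩
  obtain ⟨N, hN⟩ := exists_nat_gt c
  obtain ⟨m, hm⟩ := exists_forall_le_index_commutator.{u} N
  obtain ⟨G, _, _, ⟨e⟩, hle⟩ := hc (ULift.{u} (∀ i : Fin m, Cyc (2 ^ (i : ℕ))))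
  have hidx := hm m le_rfl (fun i => (i : ℕ)) Fin.val_injective G ⟨e.trans MulEquiv.ulift⟩
  rw [ENat.card_eq_coe_natCard, Nat.cast_le] at hidx
  rw [← Nat.card_congr e.toEquiv, Subgroup.card_eq_card_quotient_mul_card_subgroup (commutator G)]
    at hle
  push_cast at hle
  have hpos : (0 : ℝ) < Nat.card (commutator G) := by exact_mod_cast Nat.card_pos
  have h1 := le_of_mul_le_mul_right hle hpos
  have h2 : (N : ℝ) ≤ Nat.card (G ⧸ commutator G) := by exact_mod_cast hidx
  linarith

/-! ### Derived subgroups of semidirect products -/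

theorem SemidirectProduct.commutator_eq_map_closure {B Q : Type*} [CommGroup B] [CommGroup Q]
    (φ : Q →* MulAut B) :
    commutator (B ⋊[φ] Q) =
      (Subgroup.closure {x | ∃ q b, x = φ q b * b⁻¹}).map SemidirectProduct.inl := by
  apply le_antisymm
  · rw [commutator_def, Subgroup.commutator_le]
    intro g _ h _
    refine ⟨(φ g.right h.left * h.left⁻¹) * (φ h.right g.left * g.left⁻¹)⁻¹,
      mul_mem (Subgroup.subset_closure ⟨_, _, rfl⟩)
        (inv_mem (Subgroup.subset_closure ⟨_, _, rfl⟩)), ?_⟩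
    have : ⁅g, h⁆ = g * h * (h * g)⁻¹ := by rw [commutatorElement_def]; group
    rw [this, eq_mul_inv_iff_mul_eq]
    ext
    · simp only [mul_left, left_inl, right_inl, map_one, MulAut.one_apply]
      generalize φ g.right h.left = x
      generalize φ h.right g.left = y
      rw [mul_inv_rev, inv_inv]
      calc x * h.left⁻¹ * (g.left * y⁻¹) * (h.left * y)
          = (h.left⁻¹ * h.left) * (y⁻¹ * y) * (g.left * x) := by ac_rfl
        _ = g.left * x := by simp
    · simp [mul_comm]
  · rw [Subgroup.map_le_iff_le_comap, Subgroup.closure_le]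
    rintro _ ⟨q, b, rfl⟩
    have : (inl (φ q b * b⁻¹) : B ⋊[φ] Q) = ⁅(inr q : B ⋊[φ] Q), inl b⁆ := by
      rw [map_mul, inl_aut, commutatorElement_def, map_inv, map_inv]
    rw [SetLike.mem_coe, Subgroup.mem_comap, this]
    exact Subgroup.commutator_mem_commutator (Subgroup.mem_top _) (Subgroup.mem_top _)

theorem Cyc.exists_hom {M : Type*} [Group M] (n : ℕ) (g : M) (hg : g ^ n = 1) :
    ∃ f : Cyc n →* M, f (Multiplicative.ofAdd 1) = g := by
  let f : ℤ →+ Additive M := zmultiplesHom (Additive M) (Additive.ofMul g)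
  have hf : f n = 0 := by
    change (n : ℤ) • Additive.ofMul g = 0
    rw [natCast_zsmul, ← ofMul_pow, hg, ofMul_one]
  refine ⟨AddMonoidHom.toMultiplicativeLeft (ZMod.lift n ⟨f, hf⟩), ?_⟩
  have : ZMod.lift n ⟨f, hf⟩ 1 = Additive.ofMul g := by
    have := ZMod.lift_coe n ⟨f, hf⟩ 1
    rw [Int.cast_one] at this
    rw [this]
    exact one_zsmul _
  exact congrArg Additive.toMul this

/-- The automorphism `(x, y) ↦ (y⁻¹, x y⁻¹)` of `E × E`, which satisfies `g² + g + 1 = 0`. -/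
def rotateProd (E : Type*) [CommGroup E] : MulAut (E × E) where
  toFun z := (z.2⁻¹, z.1 * z.2⁻¹)
  invFun z := (z.2 * z.1⁻¹, z.1⁻¹)
  left_inv z := by ext <;> simp
  right_inv z := by ext <;> simp
  map_mul' z w := by
    ext
    · simp [mul_comm]
    · simp only [Prod.fst_mul, Prod.snd_mul, mul_inv]; ac_rfl

theorem rotateProd_pow_three (E : Type*) [CommGroup E] : rotateProd E ^ 3 = 1 := by
  ext z <;> simp [rotateProd, pow_succ]

/-- From `g² + g + 1 = 0` follows `(g - 1)(g + 2) = -3`, and cubing is bijective on `E`. -/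
theorem exists_rotateProd_mul_inv_eq {E : Type*} [CommGroup E] [Finite E]
    (hE : (Nat.card E).Coprime 3) (w : E × E) : ∃ z, w = rotateProd E z * z⁻¹ := by
  obtain ⟨c, hc⟩ := (powCoprime hE).surjective w.1
  obtain ⟨d, hd⟩ := (powCoprime hE).surjective w.2
  -- This is `-(g + 2)` applied to `(c, d)`, written additively.
  refine ⟨(d * (c ^ 2)⁻¹, (c * d)⁻¹), ?_⟩
  simp only [powCoprime_apply] at hc hd
  refine Prod.ext ?_ ?_
  · change w.1 = ((c * d)⁻¹)⁻¹ * (d * (c ^ 2)⁻¹)⁻¹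
    rw [← hc, inv_inv, mul_inv, inv_inv]
    calc c ^ 3 = (d * d⁻¹) * (c * c ^ 2) := by rw [mul_inv_cancel, one_mul, ← pow_succ']
      _ = _ := by ac_rfl
  · change w.2 = d * (c ^ 2)⁻¹ * ((c * d)⁻¹)⁻¹ * ((c * d)⁻¹)⁻¹
    rw [← hd, inv_inv]
    calc d ^ 3 = (c ^ 2 * (c ^ 2)⁻¹) * d ^ 3 := by simp
      _ = (c * c) * (c ^ 2)⁻¹ * (d * d * d) := by rw [← pow_two, ← pow_three']
      _ = _ := by ac_rfl

/-- If `E` has order prime to three, then the group of squares of `D` times `E × E` has an integral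
of order `42 |D| |E|²`, where the factor of order two inverts `D` and the factor of order three
rotates `E × E`. -/
theorem exists_integral_squares_prod {D E : Type*} [CommGroup D] [CommGroup E] [Finite E]
    (hE : (Nat.card E).Coprime 3) :
    ∃ φ : (⊤ : Subgroup (Cyc 2 × Cyc 3 × Cyc 7)) →* MulAut (D × E × E),
      IsGroupIntegral ((D × E × E) ⋊[φ] (⊤ : Subgroup (Cyc 2 × Cyc 3 × Cyc 7)))
        ((powMonoidHom 2 : D →* D).range × E × E) := by
  obtain ⟨α, hα⟩ := Cyc.exists_hom 2 (MulEquiv.inv D : MulAut D)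
    (by ext; simp [pow_two])
  obtain ⟨β, hβ⟩ := Cyc.exists_hom 3 (rotateProd E) (rotateProd_pow_three E)
  -- The factor of order seven acts trivially.
  let φ : (⊤ : Subgroup (Cyc 2 × Cyc 3 × Cyc 7)) →* MulAut (D × E × E) :=
    { toFun := fun q => MulEquiv.prodCongr (α q.1.1) (β q.1.2.1)
      map_one' := by
        rw [Subgroup.coe_one, Prod.fst_one, Prod.snd_one, map_one, Prod.fst_one, map_one]; rfl
      map_mul' := fun p q => by
        rw [Subgroup.coe_mul, Prod.fst_mul, Prod.snd_mul, map_mul, Prod.fst_mul, map_mul]; rfl }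
  have hφ (q : (⊤ : Subgroup (Cyc 2 × Cyc 3 × Cyc 7))) (b : D × E × E) :
      φ q b = (α q.1.1 b.1, β q.1.2.1 b.2) := rfl
  have hcl : Subgroup.closure {x | ∃ q b, x = φ q b * b⁻¹} =
      (powMonoidHom 2 : D →* D).range.prod ⊤ := by
    apply le_antisymm
    · rw [Subgroup.closure_le]
      rintro _ ⟨q, b, rfl⟩
      refine Subgroup.mem_prod.2 ⟨?_, Subgroup.mem_top _⟩
      have hq : ∀ q : Cyc 2, q = 1 ∨ q = Multiplicative.ofAdd 1 := by decide
      rw [hφ]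
      rcases hq q.1.1 with h | h
      · rw [h]
        exact ⟨1, by simp⟩
      · rw [h, hα]
        exact ⟨b.1⁻¹, by simp [pow_two]⟩
    · rintro ⟨_, w⟩ ⟨⟨d, rfl⟩, -⟩
      obtain ⟨z, hz⟩ := exists_rotateProd_mul_inv_eq hE w
      have h1 : ((powMonoidHom 2 d, 1) : D × E × E) ∈
          Subgroup.closure {x | ∃ q b, x = φ q b * b⁻¹} := by
        refine Subgroup.subset_closure
          ⟨⟨(Multiplicative.ofAdd 1, 1, 1), trivial⟩, (d⁻¹, 1), ?_⟩
        rw [hφ]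
        refine Prod.ext ?_ ?_
        · simp [hα, pow_two]
        · simp
      have h2 : ((1, w) : D × E × E) ∈ Subgroup.closure {x | ∃ q b, x = φ q b * b⁻¹} := by
        refine Subgroup.subset_closure
          ⟨⟨(1, Multiplicative.ofAdd 1, 1), trivial⟩, (1, z), ?_⟩
        rw [hφ]
        refine Prod.ext ?_ ?_
        · simp
        · simpa [hβ] using hz
      simpa using mul_mem h1 h2
  refine ⟨φ, ⟨?_⟩⟩
  refine (MulEquiv.subgroupCongr ((SemidirectProduct.commutator_eq_map_closure φ).trans
    (by rw [hcl]))).trans ?_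
  exact (Subgroup.equivMapOfInjective _ _ SemidirectProduct.inl_injective).symm.trans
    ((Subgroup.prodEquiv _ _).trans ((MulEquiv.refl _).prodCongr Subgroup.topEquiv))

/-! ### Pairing off equal cyclic 2-factors -/

/-- The isomorphism between two trivial groups. -/
def MulEquiv.ofSubsingleton (M N : Type*) [Group M] [Group N] [Subsingleton M] [Subsingleton N] :
    M ≃* N where
  toFun _ := 1
  invFun _ := 1
  left_inv _ := Subsingleton.elim _ _
  right_inv _ := Subsingleton.elim _ _
  map_mul' _ _ := Subsingleton.elim _ _

/-- A product over `insert i s` splits off the factor at `i`. -/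
noncomputable def MulEquiv.piInsert {ι : Type*} [DecidableEq ι] (M : ι → Type*)
    [∀ i, CommGroup (M i)] {i : ι} {s : Finset ι} (hi : i ∉ s) :
    (∀ j : ↥(insert i s), M j) ≃* M i × ∀ j : s, M j :=
  MulEquiv.ofBijective
    (⟨⟨fun x => (x ⟨i, Finset.mem_insert_self i s⟩,
      fun j => x ⟨j, Finset.mem_insert_of_mem j.2⟩), rfl⟩, fun _ _ => rfl⟩ :
        (∀ j : ↥(insert i s), M j) →* M i × ∀ j : s, M j) <| by
    constructor
    · intro x y hxy
      obtain ⟨h1, h2⟩ := Prod.ext_iff.1 hxy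
      funext ⟨j, hj⟩
      rcases Finset.mem_insert.1 hj with rfl | hj'
      · exact h1
      · exact congrFun h2 ⟨j, hj'⟩
    · rintro ⟨x, y⟩
      refine ⟨fun j => if h : j.1 = i then cast (congrArg M h.symm) x
        else y ⟨j, (Finset.mem_insert.1 j.2).resolve_left h⟩, ?_⟩
      refine Prod.ext ?_ ?_
      · simp
      · funext j
        have : j.1 ≠ i := fun h => hi (h ▸ j.2)
        simp [this]

/-- `A` is the product of a group `O` of odd order, cyclic groups of orders `2 ^ s` for `s ∈ S`,
and the square of a group `E` of order prime to three. -/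
def HasSquareDecomposition (A : Type*) [CommGroup A] : Prop :=
  ∃ (O E : Type) (_ : CommGroup O) (_ : CommGroup E) (_ : Finite O) (_ : Finite E) (S : Finset ℕ),
    (Nat.card O).Coprime 2 ∧ (Nat.card E).Coprime 3 ∧ 0 ∉ S ∧
      Nonempty (A ≃* (O × ∀ s : S, Cyc (2 ^ (s : ℕ))) × E × E)

theorem HasSquareDecomposition.of_mulEquiv {A A' : Type*} [CommGroup A] [CommGroup A'] (f : A ≃* A')
    (h : HasSquareDecomposition A') : HasSquareDecomposition A := by
  obtain ⟨O, E, _, _, _, _, S, hO, hE, hS, ⟨e⟩⟩ := h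
  exact ⟨O, E, _, _, ‹_›, ‹_›, S, hO, hE, hS, ⟨f.trans e⟩⟩

theorem HasSquareDecomposition.cyc_prod {A : Type*} [CommGroup A] (h : HasSquareDecomposition A)
    {p : ℕ} (hp : p.Prime) (k : ℕ) : HasSquareDecomposition (Cyc (p ^ k) × A) := by
  obtain ⟨O, E, _, _, _, _, S, hO, hE, hS, ⟨e⟩⟩ := h
  have hne : NeZero (p ^ k) := ⟨pow_ne_zero _ hp.ne_zero⟩
  have hcard : Nat.card (Cyc (p ^ k)) = p ^ k := Nat.card_zmod _
  let e' := (MulEquiv.refl (Cyc (p ^ k))).prodCongr e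
  by_cases hodd : (p ^ k).Coprime 2
  · refine ⟨Cyc (p ^ k) × O, E, _, _, inferInstance, ‹_›, S, ?_, hE, hS, ⟨e'.trans ?_⟩⟩
    · rw [Nat.card_prod, hcard]
      exact hodd.mul_left hO
    · exact ⟨⟨fun x => (((x.1, x.2.1.1), x.2.1.2), x.2.2),
        fun x => (x.1.1.1, ((x.1.1.2, x.1.2), x.2)),
        fun _ => rfl, fun _ => rfl⟩, fun _ _ => rfl⟩
  have hk : k ≠ 0 := by
    rintro rfl
    exact hodd (by simp)
  obtain rfl : p = 2 := by
    by_contra hp2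
    exact hodd (((Nat.coprime_primes hp Nat.prime_two).2 hp2).pow_left k)
  -- A second copy of `C_{2 ^ k}` joins the first and moves to `E × E`; a first copy enters `S`.
  by_cases hkS : k ∈ S
  · refine ⟨O, Cyc (2 ^ k) × E, _, _, ‹_›, inferInstance, S.erase k, hO, ?_,
      fun h => hS (Finset.mem_of_mem_erase h), ⟨e'.trans ?_⟩⟩
    · rw [Nat.card_prod, hcard]
      exact Nat.Coprime.mul_left (Nat.Coprime.pow_left k (by decide)) hE
    · have f := MulEquiv.piInsert (fun s : ℕ => Cyc (2 ^ s)) (Finset.notMem_erase k S)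
      rw [Finset.insert_erase hkS] at f
      refine ((MulEquiv.refl _).prodCongr
        (((MulEquiv.refl O).prodCongr f).prodCongr (MulEquiv.refl _))).trans ?_
      exact ⟨⟨fun x => ((x.2.1.1, x.2.1.2.2), ((x.1, x.2.2.1), (x.2.1.2.1, x.2.2.2))),
        fun x => (x.2.1.1, ((x.1.1, (x.2.2.1, x.1.2)), (x.2.1.2, x.2.2.2))),
        fun _ => rfl, fun _ => rfl⟩, fun _ _ => rfl⟩
  · refine ⟨O, E, _, _, ‹_›, ‹_›, insert k S, hO, hE, by simp [hS, hk.symm], ⟨e'.trans ?_⟩⟩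
    refine MulEquiv.trans ?_ (((MulEquiv.refl O).prodCongr
      (MulEquiv.piInsert (fun s : ℕ => Cyc (2 ^ s)) hkS).symm).prodCongr (MulEquiv.refl _))
    exact ⟨⟨fun x => ((x.2.1.1, (x.1, x.2.1.2)), x.2.2),
      fun x => (x.1.2.1, ((x.1.1, x.1.2.2), x.2)), fun _ => rfl, fun _ => rfl⟩, fun _ _ => rfl⟩

theorem hasSquareDecomposition_of_finite (A : Type*) [CommGroup A] [Finite A] :
    HasSquareDecomposition A := by
  classical
  obtain ⟨ι, _, p, hp, k, ⟨e⟩⟩ := AddCommGroup.equiv_directSum_zmod_of_finite (Additive A)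
  have key (T : Finset ι) : HasSquareDecomposition (∀ i : T, Cyc (p i ^ k i)) := by
    induction T using Finset.induction_on with
    | empty =>
      refine ⟨PUnit, PUnit, inferInstance, inferInstance, inferInstance, inferInstance, ∅,
        by simp, by simp, by simp, ⟨?_⟩⟩
      have : Subsingleton (∀ s : (∅ : Finset ℕ), Cyc (2 ^ (s : ℕ))) :=
        ⟨fun x y => funext isEmptyElim⟩
      have : Subsingleton (∀ i : (∅ : Finset ι), Cyc (p i ^ k i)) :=
        ⟨fun x y => funext isEmptyElim⟩
      exact MulEquiv.ofSubsingleton _ _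
    | insert i T hi ih =>
      exact (ih.cyc_prod (hp i) (k i)).of_mulEquiv
        (MulEquiv.piInsert (fun i => Cyc (p i ^ k i)) hi)
  have e₁ : A ≃* ∀ i, Cyc (p i ^ k i) := MulEquiv.toAdditive.symm <| e.trans <|
    (DirectSum.addEquivProd _).trans (MulEquiv.piMultiplicative _).toAdditiveRight
  refine (key Finset.univ).of_mulEquiv (e₁.trans ?_)
  exact ⟨⟨fun x i => x i, fun x i => x ⟨i, Finset.mem_univ i⟩, fun _ => rfl, fun _ => rfl⟩,
    fun _ _ => rfl⟩

/-! ### Square roots of the unpaired factors, and their cost -/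

theorem ZMod.two_mul_eq_zero_iff_castHom_eq_zero {s : ℕ} (x : ZMod (2 ^ (s + 1))) :
    2 * x = 0 ↔ ZMod.castHom (pow_dvd_pow 2 (Nat.le_succ s)) (ZMod (2 ^ s)) x = 0 := by
  obtain ⟨k, rfl⟩ := ZMod.natCast_zmod_surjective x
  rw [map_natCast, ZMod.natCast_eq_zero_iff]
  have : (2 * k : ZMod (2 ^ (s + 1))) = ((2 * k : ℕ) : ZMod (2 ^ (s + 1))) := by push_cast; rfl
  rw [this, ZMod.natCast_eq_zero_iff, pow_succ', Nat.mul_dvd_mul_iff_left (by norm_num)]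

/-- Squaring in `O × ∏ C_{2 ^ (s + 1)}`, with `O` of odd order, has image `O × ∏ C_{2 ^ s}`. -/
theorem nonempty_range_powMonoidHom_two_mulEquiv (O : Type*) [CommGroup O]
    (hO : (Nat.card O).Coprime 2) (S : Finset ℕ) :
    Nonempty ((powMonoidHom 2 : (O × ∀ s : S, Cyc (2 ^ ((s : ℕ) + 1))) →* _).range ≃*
      O × ∀ s : S, Cyc (2 ^ (s : ℕ))) := by
  let c (s : ℕ) : Cyc (2 ^ (s + 1)) →* Cyc (2 ^ s) := AddMonoidHom.toMultiplicative
    (ZMod.castHom (pow_dvd_pow 2 (Nat.le_succ s)) (ZMod (2 ^ s))).toAddMonoidHom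
  have hc (s : ℕ) (x : Cyc (2 ^ (s + 1))) : x ^ 2 = 1 ↔ c s x = 1 := by
    have := ZMod.two_mul_eq_zero_iff_castHom_eq_zero x.toAdd
    rw [two_mul, ← two_nsmul] at this
    exact this
  have hcs (s : ℕ) : Function.Surjective (c s) :=
    ZMod.castHom_surjective (pow_dvd_pow 2 (Nat.le_succ s))
  let π : (O × ∀ s : S, Cyc (2 ^ ((s : ℕ) + 1))) →* O × ∀ s : S, Cyc (2 ^ (s : ℕ)) :=
    (MonoidHom.id O).prodMap
      { toFun := fun x s => c s (x s)
        map_one' := by funext s; exact map_one (c s)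
        map_mul' := fun x y => by funext s; exact map_mul (c s) _ _ }
  have hπ : Function.Surjective π := by
    rintro ⟨o, y⟩
    choose x hx using fun s : S => hcs s (y s)
    exact ⟨(o, x), Prod.ext rfl (funext hx)⟩
  -- Squaring and coordinatewise reduction have the same kernel, hence isomorphic images.
  have hker : (powMonoidHom 2 : (O × ∀ s : S, Cyc (2 ^ ((s : ℕ) + 1))) →* _).ker = π.ker := by
    ext ⟨o, x⟩
    rw [MonoidHom.mem_ker, MonoidHom.mem_ker, Prod.ext_iff, Prod.ext_iff]
    refine and_congr ?_ ?_
    · change o ^ 2 = 1 ↔ o = 1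
      refine ⟨fun h => (powCoprime hO).injective ?_, fun h => by rw [h, one_pow]⟩
      simpa using h
    · rw [funext_iff, funext_iff]
      exact forall_congr' fun s => hc s (x s)
  exact ⟨(QuotientGroup.quotientKerEquivRange _).symm.trans
    ((QuotientGroup.quotientMulEquivOfEq hker).trans
      (QuotientGroup.quotientKerEquivOfSurjective π hπ))⟩

theorem Finset.card_sq_le_two_mul_sum (S : Finset ℕ) (hS : 0 ∉ S) :
    S.card ^ 2 ≤ 2 * ∑ s ∈ S, s := by
  induction S using Finset.induction_on_max with
  | empty => simp
  | insert a S hmax ih =>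
    have ha : a ∉ S := fun h => (hmax a h).false
    have hS' : 0 ∉ S := fun h => hS (Finset.mem_insert_of_mem h)
    have ha0 : a ≠ 0 := fun h => hS (h ▸ Finset.mem_insert_self a S)
    have hcard : S.card ≤ a - 1 := by
      have hsub : S ⊆ Finset.Icc 1 (a - 1) := fun x hx => by
        have h1 : x ≠ 0 := fun h => hS' (h ▸ hx)
        have h2 := hmax x hx
        rw [Finset.mem_Icc]
        omega
      simpa using Finset.card_le_card hsub
    have ih' := ih hS'
    rw [Finset.card_insert_of_notMem ha, Finset.sum_insert ha]
    -- Since `|S| ≤ a - 1`, the increment `2|S| + 1` is at most `2a`.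
    have : (S.card + 1) ^ 2 = S.card ^ 2 + (2 * S.card + 1) := by ring
    omega

theorem card_pi_cyc_two_pow (S : Finset ℕ) (f : ℕ → ℕ) :
    Nat.card (∀ s : S, Cyc (2 ^ f s)) = 2 ^ ∑ s ∈ S, f s := by
  have h (s : S) : Nat.card (Cyc (2 ^ f s)) = 2 ^ f s := Nat.card_zmod _
  rw [Nat.card_pi, Finset.prod_congr rfl fun s _ => h s, Finset.prod_pow_eq_pow_sum,
    Finset.sum_coe_sort S f]

theorem exists_integral_of_finite (A : Type u) [CommGroup A] [Finite A] :
    ∃ (B : Type u) (_ : CommGroup B) (_ : Finite B)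
      (φ : (⊤ : Subgroup (Cyc 2 × Cyc 3 × Cyc 7)) →* MulAut B) (k : ℕ),
      IsGroupIntegral (B ⋊[φ] (⊤ : Subgroup (Cyc 2 × Cyc 3 × Cyc 7))) A ∧
      Nat.card B = 2 ^ k * Nat.card A ∧ 2 ^ k ^ 2 ≤ Nat.card A ^ 2 := by
  obtain ⟨O, E, _, _, _, _, S, hO, hE, hS, ⟨e⟩⟩ := hasSquareDecomposition_of_finite A
  obtain ⟨e₂⟩ := nonempty_range_powMonoidHom_two_mulEquiv (ULift.{u} O) (by simpa using hO) S
  obtain ⟨φ, ⟨e₁⟩⟩ := exists_integral_squares_prod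
    (D := ULift.{u} O × ∀ s : S, Cyc (2 ^ ((s : ℕ) + 1))) (E := ULift.{u} E) (by simpa using hE)
  have (n : ℕ) : Finite (Cyc (2 ^ n)) := inferInstanceAs (Finite (ZMod (2 ^ n)))
  have hA : Nat.card A = Nat.card O * 2 ^ (∑ s ∈ S, s) * (Nat.card E * Nat.card E) := by
    rw [Nat.card_congr e.toEquiv, Nat.card_prod, Nat.card_prod, Nat.card_prod,
      card_pi_cyc_two_pow S fun s => s]
  refine ⟨_, _, inferInstance, φ, S.card, ⟨e₁.trans (MulEquiv.trans ?_ e.symm)⟩, ?_, ?_⟩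
  · exact (e₂.trans (MulEquiv.ulift.prodCongr (MulEquiv.refl _))).prodCongr
      (MulEquiv.ulift.prodCongr MulEquiv.ulift)
  · rw [hA, Nat.card_prod, Nat.card_prod, Nat.card_prod, Nat.card_ulift, Nat.card_ulift,
      card_pi_cyc_two_pow S fun s => s + 1, Finset.sum_add_distrib, Finset.sum_const,
      smul_eq_mul, mul_one, pow_add]
    ring
  · calc 2 ^ S.card ^ 2 ≤ 2 ^ (2 * ∑ s ∈ S, s) :=
          Nat.pow_le_pow_right two_pos (Finset.card_sq_le_two_mul_sum S hS)
      _ = (2 ^ ∑ s ∈ S, s) ^ 2 := by rw [mul_comm, pow_mul]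
      _ ≤ Nat.card A ^ 2 := by
        refine Nat.pow_le_pow_left (Nat.le_of_dvd Nat.card_pos ?_) 2
        rw [hA, mul_right_comm]
        exact dvd_mul_left _ _

/-! ### The exponent estimate -/

/-- The excess exponent `(log 42 + √(2 log 2 log n)) / log n`. -/
noncomputable def integralExcess (n : ℕ) : ℝ :=
  (Real.log 42 + √(2 * Real.log 2 * Real.log n)) / Real.log n

theorem tendsto_integralExcess : Tendsto integralExcess atTop (𝓝 0) := by
  have hlog : Tendsto (fun n : ℕ => Real.log n) atTop atTop :=
    Real.tendsto_log_atTop.comp tendsto_natCast_atTop_atTop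
  have h1 : Tendsto (fun n : ℕ => Real.log 42 / Real.log n) atTop (𝓝 0) :=
    tendsto_const_nhds.div_atTop hlog
  have h2 : Tendsto (fun n : ℕ => √(2 * Real.log 2) / √(Real.log n)) atTop (𝓝 0) :=
    tendsto_const_nhds.div_atTop (Real.tendsto_sqrt_atTop.comp hlog)
  have h := h1.add h2
  rw [add_zero] at h
  refine h.congr fun n => ?_
  rw [integralExcess, add_div, Real.sqrt_mul (x := 2 * Real.log 2) (by positivity),
    mul_div_assoc (√(2 * Real.log 2)) (√(Real.log n)), Real.sqrt_div_self, ← div_eq_mul_inv]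

theorem le_rpow_one_add_integralExcess {n k : ℕ} (hn : 1 < n) (h : 2 ^ k ^ 2 ≤ n ^ 2) :
    ((2 ^ k * n * 42 : ℕ) : ℝ) ≤ (n : ℝ) ^ (1 + integralExcess n) := by
  have hn' : (1 : ℝ) < n := by exact_mod_cast hn
  have hn0 : (0 : ℝ) < n := by linarith
  have hlog : 0 < Real.log n := Real.log_pos hn'
  have hlog2 : 0 < Real.log 2 := Real.log_pos one_lt_two
  have hk : (k : ℝ) ^ 2 * Real.log 2 ≤ 2 * Real.log n := by
    have h' : ((2 : ℝ) ^ k ^ 2) ≤ (n : ℝ) ^ 2 := by exact_mod_cast h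
    have := Real.log_le_log (by positivity) h'
    rw [Real.log_pow, Real.log_pow] at this
    exact_mod_cast this
  have hk' : k * Real.log 2 ≤ √(2 * Real.log 2 * Real.log n) := by
    apply Real.le_sqrt_of_sq_le
    calc (k * Real.log 2) ^ 2 = k ^ 2 * Real.log 2 * Real.log 2 := by ring
      _ ≤ 2 * Real.log n * Real.log 2 := by gcongr
      _ = _ := by ring
  rw [← Real.log_le_log_iff (by positivity) (by positivity), Real.log_rpow hn0, integralExcess,
    add_mul, div_mul_cancel₀ _ hlog.ne', one_mul]
  push_cast
  rw [Real.log_mul (by positivity) (by norm_num), Real.log_mul (by positivity) (by positivity),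
    Real.log_pow]
  linarith

theorem exists_excess_bound :
    ∃ ε : ℕ → ℝ, Tendsto ε atTop (𝓝 0) ∧
      ∀ (A : Type u) [CommGroup A] [Finite A],
        ∃ (B : Type u) (_ : CommGroup B) (_ : Finite B)
          (Q : Subgroup (Cyc 2 × Cyc 3 × Cyc 7)) (φ : Q →* MulAut B),
          IsGroupIntegral (B ⋊[φ] Q) A ∧
          (Nat.card (B ⋊[φ] Q) : ℝ) ≤ (Nat.card A : ℝ) ^ (1 + ε (Nat.card A)) := by
  refine ⟨integralExcess, tendsto_integralExcess, fun A _ _ => ?_⟩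
  -- For `|A| = 1` the bound is 1 whatever the exponent, so `Q` must be trivial.
  rcases (Nat.one_le_iff_ne_zero.2 Nat.card_pos.ne' : 1 ≤ Nat.card A).eq_or_lt' with h1 | h1
  · have := (Nat.card_eq_one_iff_unique.1 h1).1
    have hcard : Nat.card (A ⋊[(1 : (⊥ : Subgroup (Cyc 2 × Cyc 3 × Cyc 7)) →* MulAut A)]
        (⊥ : Subgroup (Cyc 2 × Cyc 3 × Cyc 7))) = 1 := by
      rw [SemidirectProduct.card, h1, Subgroup.card_bot]
    have := (Nat.card_eq_one_iff_unique.1 hcard).1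
    refine ⟨A, inferInstance, ‹_›, ⊥, 1, ⟨?_⟩, ?_⟩
    · exact MulEquiv.ofSubsingleton _ _
    · rw [hcard, h1]
      simp
  · obtain ⟨B, _, _, φ, k, hint, hB, hk⟩ := exists_integral_of_finite A
    refine ⟨B, _, ‹_›, ⊤, φ, hint, ?_⟩
    have h42 : Nat.card (Cyc 2 × Cyc 3 × Cyc 7) = 42 := by
      rw [Nat.card_prod, Nat.card_prod]
      exact congrArg₂ (· * ·) (Nat.card_zmod 2)
        (congrArg₂ (· * ·) (Nat.card_zmod 3) (Nat.card_zmod 7))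
    rw [SemidirectProduct.card, Subgroup.card_top, h42, hB]
    exact le_rpow_one_add_integralExcess h1 hk

theorem theoremt :
    -- (a) integrals of order at most `|A| ^ (1 + o(1))`, of the form `B ⋊ Q` with `B` finite
    -- abelian and `Q ≤ C₂ × C₃ × C₇`
    (∃ ε : ℕ → ℝ, Tendsto ε atTop (𝓝 0) ∧
      ∀ (A : Type u) [CommGroup A] [Finite A],
        ∃ (B : Type u) (_ : CommGroup B) (_ : Finite B)
          (Q : Subgroup (Cyc 2 × Cyc 3 × Cyc 7)) (φ : Q →* MulAut B),
          IsGroupIntegral (B ⋊[φ] Q) A ∧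
          (Nat.card (B ⋊[φ] Q) : ℝ) ≤ (Nat.card A : ℝ) ^ (1 + ε (Nat.card A))) ∧
    -- (b) there is no linear bound
    (¬ ∃ c : ℝ, ∀ (A : Type u) [CommGroup A] [Finite A],
        ∃ (G : Type u) (_ : Group G) (_ : Finite G),
          IsGroupIntegral G A ∧ (Nat.card G : ℝ) ≤ c * (Nat.card A : ℝ)) ∧
    -- and the index `|G : G'|` (possibly infinite) tends to infinity with `m`, uniformly over all
    -- integrals `G` of direct products of `m` cyclic 2-groups of distinct orders
    (∀ N : ℕ, ∃ m₀ : ℕ, ∀ m ≥ m₀, ∀ a : Fin m → ℕ, Function.Injective a →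
        ∀ (G : Type u) [Group G],
          IsGroupIntegral G (∀ i, Cyc (2 ^ a i)) →
          (N : ℕ∞) ≤ ENat.card (G ⧸ commutator G)) :=
  ⟨exists_excess_bound, not_exists_linear_bound, exists_forall_le_index_commutator⟩
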